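/- Let $\alpha>0$, and let $\Gamma\subset\mathbb{R}^2$ be an infinite, continuous, piecewise-$C^1$ curve, given in its natural (arc-length) parametrization by $\gamma:\mathbb{R}\to\mathbb{R}^2$: $\gamma$ is continuous, there is a locally finite set of break points such that $\gamma$ is $C^1$ (up to the end points) on every compact interval with no break point in its interior, and $|\dot\gamma(s)|=1$ off the break points. Put $$c(\Gamma)=\inf_{s\neq s'}\frac{|\gamma(s)-\gamma(s')|}{|s-s'|},$$ the infimum over pairs of points of $\Gamma$ of their distance in the plane divided by their distance along the curve, and assume $c(\Gamma)>0$. Let $m_\Gamma(M)=l_1(M\cap\Gamma)$, where $l_1$ is the one-dimensional Hausdorff measure, and let $I_\Gamma:H^1(\mathbb{R}^2)\to L^2(\mathbb{R}^2,m_\Gamma)$ be the trace operator, i.e. the bounded extension by density of the restriction map of Schwartz functions. Let $H_{\alpha,\Gamma}=-\Delta-\alpha\delta(\cdot-\Gamma)$ be the self-adjoint operator in $L^2(\mathbb{R}^2)$ associated with the closed, lower semibounded quadratic form $$q_{\alpha,\Gamma}[u]=\int_{\mathbb{R}^2}|\nabla u|^2\,dx-\alpha\int_{\mathbb{R}^2}|I_\Gamma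 u|^2\,dm_\Gamma,\qquad \operatorname{dom}q_{\alpha,\Gamma}=H^1(\mathbb{R}^2).$$ Let $\sigma(H_{\alpha,\Gamma})$ be its spectrum and $\sigma_d(H_{\alpha,\Gamma})$ its discrete spectrum, i.e. the set of isolated points of the spectrum that are eigenvalues of finite multiplicity; $\inf\emptyset=+\infty$. Then: (i) $\displaystyle\inf\sigma_d(H_{\alpha,\Gamma})\ge-\frac{\alpha^2}{4c(\Gamma)^2}$. (ii) If, in addition, $\Gamma$ is asymptotically straight, in the sense that there are $d>0$, $\mu>\frac12$ and $\omega\in(0,1)$ such that $$1-\frac{|\gamma(s)-\gamma(s')|}{|s-s'|}\le d\,\bigl[1+|s+s'|^{2\mu}\bigr]^{-1/2}$$ for all $s\ne s'$ with $s'\neq0$ and $\omega\le\frac{s}{s'}\le\omega^{-1}$, then $\displaystyle\inf\sigma(H_{\alpha,\Gamma})\ge-\frac{\alpha^2}{4c(\Gamma)^2}$. -/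

import Mathlib

open MeasureTheory Set Filter Topology
open scoped SchwartzMap LineDeriv ENNReal

namespace LeakyCurve

noncomputable section

/-! ### Curves -/

/-- The Euclidean plane. -/
abbrev Plane : Type := EuclideanSpace ℝ (Fin 2)

/-- An infinite (unbounded in both directions), continuous, piecewise `C¹` plane curve in its natural
(arc-length) parametrization `γ : ℝ → ℝ²`. The break points form a locally finite set `B`; `γ` is
`C¹` (up to the end points) on every compact interval without break points in its interior. -/
structure IsInfiniteCurve (γ : ℝ → Plane) : Prop where
  continuous : Continuous γ
  piecewise : ∃ B : Set ℝ,
    (∀ R : ℝ, (B ∩ Icc (-R) R).Finite) ∧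
    (∀ a b : ℝ, a < b → Disjoint (Ioo a b) B → ContDiffOn ℝ 1 γ (Icc a b)) ∧
    (∀ s : ℝ, s ∉ B → ‖deriv γ s‖ = 1)

/-- The constant `c(Γ)`: the infimum, over distinct points of the curve, of the Euclidean distance
divided by the distance along the curve. In the natural parametrization the distance
along the curve between the points with parameters `s` and `s'` is `|s - s'|`. -/
def chordArc (γ : ℝ → Plane) : ℝ :=
  ⨅ p : {p : ℝ × ℝ // p.1 ≠ p.2}, dist (γ p.1.1) (γ p.1.2) / |p.1.1 - p.1.2|

/-- Asymptotic straightness: with some `d > 0`, `μ > 1/2` and `ω ∈ (0, 1)`,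
`1 - |γ(s) - γ(s')| / |s - s'| ≤ d (1 + |s + s'|^{2μ})^{-1/2}` for all distinct `s, s'` in the sector
`ω ≤ s / s' ≤ ω⁻¹`. -/
def AsymptoticallyStraight (γ : ℝ → Plane) : Prop :=
  ∃ d μ ω : ℝ, 0 < d ∧ 1 / 2 < μ ∧ 0 < ω ∧ ω < 1 ∧
    ∀ s s' : ℝ, s' ≠ 0 → s ≠ s' → ω ≤ s / s' → s / s' ≤ ω⁻¹ →
      1 - dist (γ s) (γ s') / |s - s'| ≤ d * (1 + |s + s'| ^ (2 * μ)) ^ (-(1 / 2) : ℝ)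

/-- The measure `m_Γ(M) = l₁(M ∩ Γ)`, where `l₁` is the one-dimensional Hausdorff measure. -/
def curveMeasure (γ : ℝ → Plane) : Measure Plane :=
  (Measure.hausdorffMeasure 1).restrict (range γ)

/-! ### The Sobolev space `H¹(ℝ²)` -/

/-- `L²(ℝ²)`, complex valued. -/
abbrev L2 : Type := Lp ℂ 2 (volume : Measure Plane)

/-- The `j`-th standard unit vector. -/
abbrev unitVec (j : Fin 2) : Plane := EuclideanSpace.single j (1 : ℝ)

/-- The Hilbert space of pairs `(u, p)`, `u ∈ L²(ℝ²)`, `p ∈ L²(ℝ²)²`, with norm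
`(‖u‖² + ‖p₀‖² + ‖p₁‖²)^{1/2}`. -/
abbrev L2Jet : Type := WithLp 2 (L2 × PiLp 2 (fun _ : Fin 2 => L2))

/-- The Sobolev space `H¹(ℝ²) = W^{1,2}(ℝ²)` with its usual inner product. A function `u` is
represented by the pair `(u, ∇u)`, where `∇u` is the distributional gradient, which is required to
lie in `L²`. -/
def H1 : Submodule ℂ L2Jet where
  carrier := {w | ∀ j : Fin 2,
    ∂_{unitVec j} (Lp.toTemperedDistribution w.fst) = Lp.toTemperedDistribution (w.snd j)}
  add_mem' := by
    intro a b ha hb j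
    have h1 := ha j
    have h2 := hb j
    simp only [← Lp.toTemperedDistributionCLM_apply] at h1 h2 ⊢
    simp only [WithLp.add_fst, WithLp.add_snd, PiLp.add_apply, map_add, LineDeriv.lineDerivOp_add,
      h1, h2]
  zero_mem' := by
    intro j
    simp only [← Lp.toTemperedDistributionCLM_apply]
    simp only [WithLp.zero_fst, WithLp.zero_snd, PiLp.zero_apply, map_zero,
      LineDeriv.lineDerivOp_zero]
  smul_mem' := by
    intro c a ha j
    have h1 := ha j
    simp only [← Lp.toTemperedDistributionCLM_apply] at h1 ⊢
    simp only [WithLp.smul_fst, WithLp.smul_snd, PiLp.smul_apply, map_smul,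
      LineDeriv.lineDerivOp_smul, h1]

/-- The inclusion of `H¹(ℝ²)` into `L²(ℝ²)`. -/
def toL2 : H1 →ₗ[ℂ] L2 where
  toFun w := (w : L2Jet).fst
  map_add' _ _ := rfl
  map_smul' _ _ := rfl

/-- The weak partial derivative `∂_j w` of `w ∈ H¹(ℝ²)`. -/
def partialDeriv (j : Fin 2) : H1 →ₗ[ℂ] L2 where
  toFun w := (w : L2Jet).snd j
  map_add' _ _ := rfl
  map_smul' _ _ := rfl

/-- The pair `(φ, ∇φ)` for a Schwartz function `φ`. -/
def schwartzJet (φ : 𝓢(Plane, ℂ)) : L2Jet :=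
  WithLp.toLp 2 (φ.toLp 2 volume,
    WithLp.toLp 2 fun j : Fin 2 => (∂_{unitVec j} φ : 𝓢(Plane, ℂ)).toLp 2 volume)

/-- The inclusion of the Schwartz space into `H¹(ℝ²)`. -/
def schwartzToH1 : 𝓢(Plane, ℂ) →ₗ[ℂ] H1 where
  toFun φ := ⟨schwartzJet φ, by
    intro j
    simp [schwartzJet, TemperedDistribution.lineDerivOp_toTemperedDistributionCLM_eq]⟩
  map_add' φ ψ := by
    apply Subtype.ext
    simp only [schwartzJet, LineDeriv.lineDerivOp_add]
    rfl
  map_smul' c φ := by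
    apply Subtype.ext
    simp only [schwartzJet, LineDeriv.lineDerivOp_smul]
    rfl

/-! ### The trace and the Schrödinger operator with a `δ`-interaction -/

open Classical in
/-- The restriction of Schwartz functions to `L²(ν)` (for a measure of temperate growth, so that all
Schwartz functions are square integrable with respect to `ν`). -/
def restrictSchwartz (ν : Measure Plane) : 𝓢(Plane, ℂ) →ₗ[ℂ] Lp ℂ 2 ν :=
  if h : ν.HasTemperateGrowth then (SchwartzMap.toLpCLM ℂ ℂ 2 ν (hμ := h)).toLinearMap else 0

/-- The trace `I_ν : H¹(ℝ²) → L²(ν)`: the extension by density of the restriction map of Schwartz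
functions. -/
def trace (ν : Measure Plane) : H1 →L[ℂ] Lp ℂ 2 ν :=
  (restrictSchwartz ν).extendOfNorm schwartzToH1

/-- The sesquilinear form (antilinear in the first argument)
`q_{α,ν}[v, w] = ∫ conj ∇v · ∇w dx - α ∫ conj (I_ν v) (I_ν w) dν` on `H¹(ℝ²)`. -/
def form (α : ℝ) (ν : Measure Plane) (v w : H1) : ℂ :=
  ∑ j : Fin 2, inner ℂ (partialDeriv j v) (partialDeriv j w) - α * inner ℂ (trace ν v) (trace ν w)

/-- The graph of the operator associated with the form `q_{α,ν}`: the pairs `(u, f)` with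
`u ∈ H¹(ℝ²)`, `f ∈ L²(ℝ²)` and `q_{α,ν}[v, u] = ⟨v, f⟩` for all `v ∈ H¹(ℝ²)`. -/
def formGraph (α : ℝ) (ν : Measure Plane) : Submodule ℂ (L2 × L2) where
  carrier := {x | ∃ w : H1, (toL2 w) = x.1 ∧ ∀ v : H1, form α ν v w = inner ℂ (toL2 v) x.2}
  add_mem' := by
    rintro x y ⟨w, hw, hx⟩ ⟨w', hw', hy⟩
    refine ⟨w + w', ?_, fun v => ?_⟩
    · rw [Prod.fst_add, ← hw, ← hw']
      rfl
    · rw [Prod.snd_add, inner_add_right, ← hx v, ← hy v]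
      simp only [form, map_add, inner_add_right, Finset.sum_add_distrib]
      ring
  zero_mem' := by
    refine ⟨0, rfl, fun v => ?_⟩
    simp [form]
  smul_mem' := by
    rintro c x ⟨w, hw, hx⟩
    refine ⟨c • w, ?_, fun v => ?_⟩
    · rw [Prod.smul_fst, ← hw]
      rfl
    · rw [Prod.smul_snd, inner_smul_right, ← hx v]
      simp only [form, map_smul, inner_smul_right, ← Finset.mul_sum]
      ring

/-- `formGraph` is indeed the graph of an operator. -/
theorem formGraph_functional (α : ℝ) (ν : Measure Plane) (x : L2 × L2)
    (hx : x ∈ formGraph α ν) (h0 : x.1 = 0) : x.2 = 0 := by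
  obtain ⟨w, hw, h⟩ := hx
  have hw0 : w = 0 := by
    have hfst : (w : L2Jet).fst = 0 := hw.trans h0
    have hsnd : ∀ j, (w : L2Jet).snd j = 0 := by
      intro j
      have h1 := w.2 j
      rw [hfst, ← Lp.toTemperedDistributionCLM_apply, ← Lp.toTemperedDistributionCLM_apply,
        map_zero, LineDeriv.lineDerivOp_zero] at h1
      have h2 : (w : L2Jet).snd j ∈ (Lp.toTemperedDistributionCLM ℂ
          (volume : Measure Plane) 2).ker := h1.symm
      rwa [Lp.ker_toTemperedDistributionCLM_eq_bot, Submodule.mem_bot] at h2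
    apply Subtype.ext
    apply WithLp.ofLp_injective
    exact Prod.ext hfst (PiLp.ext hsnd)
  have hz : ∀ φ : 𝓢(Plane, ℂ), inner ℂ (φ.toLp 2 : L2) x.2 = 0 := by
    intro φ
    have h1 := h (schwartzToH1 φ)
    rw [hw0] at h1
    simp only [form, map_zero, inner_zero_right, Finset.sum_const_zero, mul_zero,
      sub_zero] at h1
    exact h1.symm
  have hd : DenseRange (SchwartzMap.toLpCLM ℝ ℂ 2 (volume : Measure Plane)) :=
    SchwartzMap.denseRange_toLpCLM (by simp)
  have hall : ∀ g : L2, inner ℂ g x.2 = 0 := fun g =>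
    hd.induction_on (p := fun g : L2 => inner ℂ g x.2 = 0) g
      (isClosed_eq (by fun_prop) continuous_const) hz
  exact inner_self_eq_zero.mp (hall x.2)

/-- The operator associated with the form `q_{α,ν}`. -/
def formOperator (α : ℝ) (ν : Measure Plane) : L2 →ₗ.[ℂ] L2 := (formGraph α ν).toLinearPMap

/-- The operator `H_{α,Γ} = -Δ - α δ(· - Γ)` in `L²(ℝ²)`. -/
def hamiltonian (α : ℝ) (γ : ℝ → Plane) : L2 →ₗ.[ℂ] L2 := formOperator α (curveMeasure γ)

/-! ### Spectrum of unbounded operators -/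

section Spectrum

variable {E : Type*} [NormedAddCommGroup E] [NormedSpace ℂ E]

/-- The spectrum of an unbounded operator `T`: the numbers `z` for which `T - z` has no bounded,
everywhere defined inverse. -/
def spec (T : E →ₗ.[ℂ] E) : Set ℂ :=
  {z | ¬ ∃ R : E →L[ℂ] E,
    (∀ f : E, ∃ h : R f ∈ T.domain, T ⟨R f, h⟩ - z • R f = f) ∧
    (∀ u : T.domain, R (T u - z • (u : E)) = u)}

/-- The eigenspace `ker (T - z)`. -/
def eigenspace (T : E →ₗ.[ℂ] E) (z : ℂ) : Submodule ℂ E :=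
  T.graph.comap (LinearMap.id.prod (z • LinearMap.id))

/-- The discrete spectrum of a self-adjoint operator: the isolated points of the spectrum that are
eigenvalues of finite multiplicity. -/
def discreteSpec (T : E →ₗ.[ℂ] E) : Set ℂ :=
  {z | z ∈ spec T ∧ (∃ ε > 0, spec T ∩ Metric.ball z ε = {z}) ∧
    eigenspace T z ≠ ⊥ ∧ FiniteDimensional ℂ (eigenspace T z)}

/-- The infimum, in the extended reals, of a set of spectral values (`+∞` for the empty set, `-∞`
for a set that is not bounded below). For a self-adjoint operator the spectrum is real, so that this
is the usual infimum; in general it is the infimum of the real parts. -/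
def infSpec (S : Set ℂ) : EReal := sInf ((fun z : ℂ => (z.re : EReal)) '' S)

end Spectrum

end

end LeakyCurve

open MeasureTheory Set Filter Topology
open scoped SchwartzMap LineDeriv ENNReal


namespace LeakyCurve

/-! Write c for c(Γ). Everything rests on a trace inequality with explicit constant, `trace_le`: for
every κ > 0, 2cκ‖I_Γ u‖² ≤ ‖∇u‖² + κ²‖u‖² on H¹. Taking κ = α/(2c) gives q[u] ≥ -α²/(4c²)‖u‖². If Re
z lies strictly below this bound, a slightly larger κ makes the shifted form coercive in the H¹
norm, and Lax–Milgram produces a bounded resolvent at z. Hence the whole spectrum, and with it the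
discrete spectrum, lies to the right of the bound.

The trace inequality is proved by duality on the Fourier side. Let F be the Fourier transform of the
measure (φ∘γ) ds on an arc. Then ∫|F|²/(4π²|ξ|² + κ²) dξ is the quadratic form of the resolvent
kernel of -Δ + κ² restricted to the curve. Writing that kernel as ∫₀^∞ e^{-κ²t} (heat kernel) dt
reduces the estimate to heat kernels. These decrease with distance, so |γ(s) - γ(s')| may be
replaced by c|s - s'|. The result is a convolution kernel of total mass 1/(2c√(πt)), and Schur's
test applies. Integrating in t gives the constant 1/(2cκ).

The inequality passes from Schwartz functions to H¹ by `denseRange_schwartzToH1`. -/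

/-! ### The Hilbert space H¹: norm, completeness, injectivity into L². -/

theorem norm_sq_eq (w : H1) : ‖w‖ ^ 2 = ‖toL2 w‖ ^ 2 + ∑ j, ‖partialDeriv j w‖ ^ 2 := by
  rw [Submodule.coe_norm, WithLp.prod_norm_sq_eq_of_L2, PiLp.norm_sq_eq_of_L2]
  rfl

theorem inner_eq (v w : H1) : inner ℂ v w =
    inner ℂ (toL2 v) (toL2 w) + ∑ j, inner ℂ (partialDeriv j v) (partialDeriv j w) := by
  rw [Submodule.coe_inner, WithLp.prod_inner_apply, PiLp.inner_apply]
  rfl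

theorem norm_toL2_le (w : H1) : ‖toL2 w‖ ≤ 1 * ‖w‖ := by
  rw [one_mul]
  refine abs_le_of_sq_le_sq' ?_ (norm_nonneg _) |>.2
  rw [norm_sq_eq]
  have : 0 ≤ ∑ j, ‖partialDeriv j w‖ ^ 2 := by positivity
  linarith

theorem norm_partialDeriv_le (j : Fin 2) (w : H1) : ‖partialDeriv j w‖ ≤ 1 * ‖w‖ := by
  rw [one_mul]
  refine abs_le_of_sq_le_sq' ?_ (norm_nonneg _) |>.2
  rw [norm_sq_eq]
  have : ‖partialDeriv j w‖ ^ 2 ≤ ∑ j, ‖partialDeriv j w‖ ^ 2 :=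
    Finset.single_le_sum (f := fun j => ‖partialDeriv j w‖ ^ 2) (fun i _ => by positivity)
      (Finset.mem_univ j)
  have := sq_nonneg ‖toL2 w‖
  linarith

/-- The inclusion `H¹(ℝ²) → L²(ℝ²)` as a bounded operator. -/
noncomputable def toL2CLM : H1 →L[ℂ] L2 := toL2.mkContinuous 1 norm_toL2_le

/-- The weak derivative `∂_j : H¹(ℝ²) → L²(ℝ²)` as a bounded operator. -/
noncomputable def partialDerivCLM (j : Fin 2) : H1 →L[ℂ] L2 :=
  (partialDeriv j).mkContinuous 1 (norm_partialDeriv_le j)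

@[simp] theorem toL2CLM_apply (w : H1) : toL2CLM w = toL2 w := rfl

@[simp] theorem partialDerivCLM_apply (j : Fin 2) (w : H1) :
    partialDerivCLM j w = partialDeriv j w := rfl

/-- Distributional differentiation and the embedding of L² into tempered distributions are
continuous, so the defining equations are closed conditions. -/
theorem isClosed_H1 : IsClosed (H1 : Set L2Jet) := by
  have : (H1 : Set L2Jet) = ⋂ j : Fin 2, {w : L2Jet |
      ∂_{unitVec j} (Lp.toTemperedDistributionCLM ℂ (volume : Measure Plane) 2 w.fst) =
        Lp.toTemperedDistributionCLM ℂ (volume : Measure Plane) 2 (w.snd j)} := by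
    ext w
    simp only [mem_iInter, mem_ofPred_eq]
    rfl
  rw [this]
  refine isClosed_iInter fun j => ?_
  have h1 : Continuous fun w : L2Jet => w.fst := by fun_prop
  have h2 : Continuous fun w : L2Jet => w.snd j := by fun_prop
  refine isClosed_eq ?_ ?_
  · exact (LineDeriv.lineDerivOpCLM ℂ 𝓢'(Plane, ℂ) (unitVec j)).continuous.comp
      ((Lp.toTemperedDistributionCLM ℂ (volume : Measure Plane) 2).continuous.comp h1)
  · exact (Lp.toTemperedDistributionCLM ℂ (volume : Measure Plane) 2).continuous.comp h2

instance : CompleteSpace H1 := isClosed_H1.completeSpace_coe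

theorem toL2_injective {w : H1} (h : toL2 w = 0) : w = 0 := by
  have hsnd : ∀ j, (w : L2Jet).snd j = 0 := by
    intro j
    have h1 := w.2 j
    rw [show (w : L2Jet).fst = 0 from h, ← Lp.toTemperedDistributionCLM_apply,
      ← Lp.toTemperedDistributionCLM_apply, map_zero, LineDeriv.lineDerivOp_zero] at h1
    have h2 : (w : L2Jet).snd j ∈ (Lp.toTemperedDistributionCLM ℂ
        (volume : Measure Plane) 2).ker := h1.symm
    rwa [Lp.ker_toTemperedDistributionCLM_eq_bot, Submodule.mem_bot] at h2
  exact Subtype.ext (WithLp.ofLp_injective _ (Prod.ext h (PiLp.ext hsnd)))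

/-! ### Density of the Schwartz functions -/

open FourierTransform Laplacian in
-- On the Fourier side the equation says (1 + 4π²|ξ|²)Û = 0. The symbol has a smooth reciprocal of
-- temperate growth, so it can be divided out.
theorem eq_zero_of_laplacian_eq_self {U : 𝓢'(Plane, ℂ)} (h : Δ U = U) : U = 0 := by
  -- `g` is the symbol of 1 - Δ and `k` its reciprocal. The dilation by 2π matches the normalization
  -- of the Fourier transform, and temperate growth is inherited from the undilated functions.
  set g : Plane → ℂ := fun x => ((1 + ‖(2 * Real.pi) • x‖ ^ 2 : ℝ) : ℂ)
  set k : Plane → ℂ := fun x => (((1 + ‖(2 * Real.pi) • x‖ ^ 2) ^ (-1 : ℝ) : ℝ) : ℂ)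
  have hlin : (fun x : Plane => (2 * Real.pi) • x).HasTemperateGrowth :=
    ((2 * Real.pi) • ContinuousLinearMap.id ℝ Plane).hasTemperateGrowth
  have hg : g.HasTemperateGrowth := by
    have : (fun x : Plane => ((1 + ‖x‖ ^ 2 : ℝ) : ℂ)).HasTemperateGrowth := by fun_prop
    exact this.comp hlin
  have hk : k.HasTemperateGrowth := by
    have : (fun x : Plane => (((1 + ‖x‖ ^ 2) ^ (-1 : ℝ) : ℝ) : ℂ)).HasTemperateGrowth := by
      fun_prop
    exact this.comp hlin
  have hn : (fun x : Plane => ((‖x‖ ^ 2 : ℝ) : ℂ)).HasTemperateGrowth := by fun_prop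
  have h1 : TemperedDistribution.fourierMultiplierCLM ℂ g U = 0 := by
    have : g = fun x => 1 + ((2 * Real.pi) ^ 2 : ℂ) * ((‖x‖ ^ 2 : ℝ) : ℂ) := by
      ext x
      simp only [g, norm_smul, mul_pow, Real.norm_eq_abs, sq_abs]
      push_cast
      ring
    have hc : (fun _ : Plane => (1 : ℂ)).HasTemperateGrowth := by fun_prop
    have hcn : (fun x : Plane => ((2 * Real.pi) ^ 2 : ℂ) * ((‖x‖ ^ 2 : ℝ) : ℂ)).HasTemperateGrowth :=
      by fun_prop
    have hsm := TemperedDistribution.fourierMultiplierCLM_smul (F := ℂ) hn ((2 * Real.pi) ^ 2 : ℂ)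
    have hadd : TemperedDistribution.fourierMultiplierCLM ℂ g U =
        TemperedDistribution.fourierMultiplierCLM ℂ (fun _ => 1) U +
        TemperedDistribution.fourierMultiplierCLM ℂ
          (((2 * Real.pi) ^ 2 : ℂ) • fun x : Plane => ((‖x‖ ^ 2 : ℝ) : ℂ)) U := by
      simp only [TemperedDistribution.fourierMultiplierCLM_apply, ← FourierTransform.fourierInv_add]
      rw [this]
      congr 1
      exact congrArg (fun L : 𝓢'(Plane, ℂ) →L[ℂ] 𝓢'(Plane, ℂ) => L (𝓕 U))
        (TemperedDistribution.smulLeftCLM_add hc hcn)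
    have hL := h
    rw [TemperedDistribution.laplacian_eq_fourierMultiplierCLM] at hL
    rw [hadd, hsm, TemperedDistribution.fourierMultiplierCLM_const]
    have e2 : U = -(((2 * Real.pi) ^ 2 : ℂ) •
        TemperedDistribution.fourierMultiplierCLM ℂ (fun x : Plane => ((‖x‖ ^ 2 : ℝ) : ℂ)) U) := by
      conv_lhs => rw [← hL]
      rw [neg_smul, ← Complex.coe_smul]
      push_cast
      rfl
    change (1 : ℂ) • U + ((2 * Real.pi) ^ 2 : ℂ) •
        TemperedDistribution.fourierMultiplierCLM ℂ (fun x : Plane => ((‖x‖ ^ 2 : ℝ) : ℂ)) U = 0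
    rw [one_smul]
    conv_lhs => enter [1]; rw [e2]
    exact neg_add_cancel _
  have h2 : TemperedDistribution.fourierMultiplierCLM ℂ k
      (TemperedDistribution.fourierMultiplierCLM ℂ g U) = U := by
    rw [TemperedDistribution.fourierMultiplierCLM_fourierMultiplierCLM_apply hg hk]
    have : k * g = fun _ => 1 := by
      ext x
      simp only [g, k, Pi.mul_apply, Real.rpow_neg_one]
      rw [← Complex.ofReal_mul, inv_mul_cancel₀ (by positivity), Complex.ofReal_one]
    rw [mul_comm, this, TemperedDistribution.fourierMultiplierCLM_const]
    simp
  rw [← h2, h1, map_zero]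

/-- Complex conjugation of Schwartz functions. -/
noncomputable def schwartzConj (φ : 𝓢(Plane, ℂ)) : 𝓢(Plane, ℂ) :=
  φ.postcompCLM (Complex.conjCLE : ℂ →L[ℝ] ℂ)

theorem schwartzConj_apply (φ : 𝓢(Plane, ℂ)) (x : Plane) :
    schwartzConj φ x = starRingEnd ℂ (φ x) := rfl

theorem lineDeriv_schwartzConj (φ : 𝓢(Plane, ℂ)) (m : Plane) :
    (∂_{m} (schwartzConj φ) : 𝓢(Plane, ℂ)) = schwartzConj (∂_{m} φ) := by
  ext x
  rw [schwartzConj_apply, SchwartzMap.lineDerivOp_apply_eq_fderiv,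
    SchwartzMap.lineDerivOp_apply_eq_fderiv]
  have h : HasFDerivAt (schwartzConj φ) ((Complex.conjCLE : ℂ →L[ℝ] ℂ) ∘L fderiv ℝ φ x) x :=
    (Complex.conjCLE : ℂ →L[ℝ] ℂ).hasFDerivAt.comp x (φ.differentiableAt (x := x)).hasFDerivAt
  rw [h.fderiv]
  rfl

/-- The inner product is antilinear in its first slot while the distributional pairing is bilinear;
conjugating the test function reconciles them. -/
theorem inner_schwartzConj_toLp (φ : 𝓢(Plane, ℂ)) (u : L2) :
    inner ℂ ((schwartzConj φ).toLp 2 : L2) u = Lp.toTemperedDistribution u φ := by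
  rw [Lp.toTemperedDistribution_apply, MeasureTheory.L2.inner_def]
  refine integral_congr_ae ?_
  filter_upwards [(schwartzConj φ).coeFn_toLp 2 volume] with x hx
  rw [hx, schwartzConj_apply]
  simp [mul_comm]

/-- An element of H¹ orthogonal to all Schwartz functions satisfies Δu = u weakly, hence vanishes.
-/
theorem denseRange_schwartzToH1 : DenseRange schwartzToH1 := by
  have : (LinearMap.range schwartzToH1).topologicalClosure = ⊤ := by
    refine (Submodule.topologicalClosure_eq_top_iff (E := H1) (𝕜 := ℂ)).2
      ((Submodule.eq_bot_iff _).2 fun w hw => ?_)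
    refine toL2_injective ?_
    set U : 𝓢'(Plane, ℂ) := Lp.toTemperedDistribution (toL2 w)
    have hU : Laplacian.laplacian U = U := by
      ext φ
      have h0 := hw (schwartzToH1 (schwartzConj φ)) ⟨_, rfl⟩
      rw [inner_eq] at h0
      have ha : inner ℂ (toL2 (schwartzToH1 (schwartzConj φ))) (toL2 w) = U φ :=
        inner_schwartzConj_toLp φ _
      have hb : ∀ j, inner ℂ (partialDeriv j (schwartzToH1 (schwartzConj φ))) (partialDeriv j w) =
          - (∂_{unitVec j} (∂_{unitVec j} U) : 𝓢'(Plane, ℂ)) φ := by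
        intro j
        have : partialDeriv j (schwartzToH1 (schwartzConj φ)) =
          (schwartzConj (∂_{unitVec j} φ)).toLp 2 := by
          rw [← lineDeriv_schwartzConj]; rfl
        rw [this, inner_schwartzConj_toLp]
        change Lp.toTemperedDistribution ((w : L2Jet).snd j) _ = _
        rw [← w.2 j]
        change (∂_{unitVec j} U : 𝓢'(Plane, ℂ)) _ = _
        simp
      rw [ha] at h0
      simp only [hb] at h0
      rw [TemperedDistribution.laplacian_eq_sum (EuclideanSpace.basisFun (Fin 2) ℝ)]
      simp only [EuclideanSpace.basisFun_apply]
      simp only [Fin.sum_univ_two] at h0 ⊢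
      have hadd (V W : 𝓢'(Plane, ℂ)) : (V + W) φ = V φ + W φ := rfl
      rw [hadd]
      linear_combination -h0
    have h2 : toL2 w ∈ (Lp.toTemperedDistributionCLM ℂ (volume : Measure Plane) 2).ker :=
      eq_zero_of_laplacian_eq_self hU
    rwa [Lp.ker_toTemperedDistributionCLM_eq_bot, Submodule.mem_bot] at h2
  rw [DenseRange, dense_iff_closure_eq]
  exact congrArg SetLike.coe this

/-! ### Spectrum and lower bounds of the form -/

theorem mem_graph_formOperator {α : ℝ} {ν : Measure Plane} {u f : L2} :
    (u, f) ∈ (formOperator α ν).graph ↔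
      ∃ w : H1, toL2 w = u ∧ ∀ v : H1, form α ν v w = inner ℂ (toL2 v) f := by
  rw [formOperator, Submodule.toLinearPMap_graph_eq _ (formGraph_functional α ν)]
  rfl

open ContinuousLinearMap in
/-- A version of the Lax–Milgram theorem for the form
`∑ ⟪D_j v, D_j w⟫ - α ⟪T v, T w⟫ - z ⟪J v, J w⟫`. -/
theorem exists_solution_operator {H E F ι : Type*} [Fintype ι]
    [NormedAddCommGroup H] [InnerProductSpace ℂ H] [CompleteSpace H]
    [NormedAddCommGroup E] [InnerProductSpace ℂ E] [CompleteSpace E]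
    [NormedAddCommGroup F] [InnerProductSpace ℂ F] [CompleteSpace F]
    (D : ι → H →L[ℂ] E) (T : H →L[ℂ] F) (J : H →L[ℂ] E) {α : ℝ} {z : ℂ} {δ : ℝ} (hδ : 0 < δ)
    (h : ∀ w : H, δ * ‖w‖ ^ 2 ≤ ∑ j, ‖D j w‖ ^ 2 - α * ‖T w‖ ^ 2 - z.re * ‖J w‖ ^ 2) :
    ∃ S : E →L[ℂ] H, ∀ (f : E) (w : H), S f = w ↔ ∀ v : H,
      ∑ j, inner ℂ (D j v) (D j w) - α * inner ℂ (T v) (T w) - z * inner ℂ (J v) (J w) =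
        inner ℂ (J v) f := by
  set A : H →L[ℂ] H := ∑ j, (adjoint (D j)) ∘L D j
    - (α : ℂ) • (adjoint T ∘L T) - z • (adjoint J ∘L J)
  have hA : ∀ v w, inner ℂ v (A w) = ∑ j, inner ℂ (D j v) (D j w) - α * inner ℂ (T v) (T w)
      - z * inner ℂ (J v) (J w) := by
    intro v w
    simp [A, adjoint_inner_right]
  have hu : IsUnit A := by
    -- Coercivity: |⟨w, Aw⟩| ≥ Re⟨w, Aw⟩, and only Re z enters the real part.
    refine isUnit_of_forall_le_norm_inner_map A (c := ⟨δ, hδ.le⟩) hδ fun w => ?_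
    rw [norm_inner_symm, hA]
    refine le_trans ?_ (Complex.re_le_norm _)
    have := h w
    simp only [inner_self_eq_norm_sq_to_K, Complex.coe_algebraMap, ← Complex.ofReal_pow,
      Complex.sub_re, Complex.re_sum, Complex.mul_re, Complex.ofReal_re, Complex.ofReal_im,
      mul_zero, sub_zero]
    change ‖w‖ ^ 2 * δ ≤ _
    linarith
  obtain ⟨e, he⟩ := hu
  have hAS : ∀ w, A ((↑e⁻¹ : H →L[ℂ] H) w) = w := fun w => by
    rw [← he]; exact congrArg (fun f : H →L[ℂ] H => f w) e.mul_inv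
  have hSA : ∀ w, (↑e⁻¹ : H →L[ℂ] H) (A w) = w := fun w => by
    rw [← he]; exact congrArg (fun f : H →L[ℂ] H => f w) e.inv_mul
  refine ⟨(↑e⁻¹ : H →L[ℂ] H) ∘L adjoint J, fun f w => ⟨?_, fun hw => ?_⟩⟩
  · rintro rfl v
    rw [← hA, comp_apply, hAS, adjoint_inner_right]
  · have : A w = adjoint J f := by
      refine ext_inner_left ℂ fun v => ?_
      rw [hA, hw, adjoint_inner_right]
    rw [comp_apply, ← this, hSA]

/-- Coercivity gives a solution operator S from L² to H¹ for the shifted form; composed with the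
inclusion into L², it is the resolvent at z. -/
theorem notMem_spec_formOperator {α : ℝ} {ν : Measure Plane} {z : ℂ} {δ : ℝ} (hδ : 0 < δ)
    (h : ∀ w : H1, δ * ‖w‖ ^ 2 ≤
      ∑ j, ‖partialDeriv j w‖ ^ 2 - α * ‖trace ν w‖ ^ 2 - z.re * ‖toL2 w‖ ^ 2) :
    z ∉ spec (formOperator α ν) := by
  obtain ⟨S, hS⟩ : ∃ S : L2 →L[ℂ] H1, ∀ (f : L2) (w : H1), S f = w ↔ ∀ v : H1,
      form α ν v w - z * inner ℂ (toL2 v) (toL2 w) = inner ℂ (toL2 v) f := by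
    obtain ⟨S, hS⟩ := exists_solution_operator (H := H1) (E := L2) (F := Lp ℂ 2 ν)
      (ι := Fin 2) partialDerivCLM (trace ν) toL2CLM hδ (α := α) (z := z) (by simpa using h)
    exact ⟨S, by simpa [form] using hS⟩
  intro hz
  refine hz ⟨toL2CLM ∘L S, fun f => ?_, fun u => ?_⟩
  · have hw : (toL2 (S f), f + z • toL2 (S f)) ∈ (formOperator α ν).graph := by
      refine mem_graph_formOperator.2 ⟨S f, rfl, fun v => ?_⟩
      rw [inner_add_right, inner_smul_right, ← (hS f _).1 rfl v]
      ring
    obtain ⟨y, hy1, hy2⟩ := (LinearPMap.mem_graph_iff _).1 hw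
    have hmem : toL2 (S f) ∈ (formOperator α ν).domain := by
      have := y.2
      rwa [hy1] at this
    refine ⟨hmem, ?_⟩
    have : y = ⟨toL2 (S f), hmem⟩ := Subtype.ext hy1
    change formOperator α ν ⟨toL2 (S f), hmem⟩ - z • toL2 (S f) = f
    rw [← this, hy2, add_sub_cancel_right]
  · obtain ⟨w, hw1, hw2⟩ := mem_graph_formOperator.1 ((formOperator α ν).mem_graph u)
    have : S (formOperator α ν u - z • (u : L2)) = w := by
      refine (hS _ _).2 fun v => ?_
      rw [inner_sub_right, inner_smul_right, ← hw2, hw1]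
    rw [ContinuousLinearMap.comp_apply, this, toL2CLM_apply, hw1]

/-! ### Restrictions of Schwartz functions to chord-arc curves -/

/-- The character `x ↦ exp (2πi ⟪ξ, x⟫)`. -/
noncomputable def char (ξ x : Plane) : ℂ := Complex.exp ((2 * Real.pi * inner ℝ ξ x : ℝ) * Complex.I)

theorem norm_char (ξ x : Plane) : ‖char ξ x‖ = 1 := Complex.norm_exp_ofReal_mul_I _

theorem continuous_char {X : Type*} [TopologicalSpace X] {f g : X → Plane} (hf : Continuous f)
    (hg : Continuous g) : Continuous fun x => char (f x) (g x) := by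
  unfold char
  fun_prop

theorem char_mul_conj (ξ x y : Plane) :
    char ξ x * starRingEnd ℂ (char ξ y) = char ξ (x - y) := by
  rw [char, char, char, ← Complex.exp_conj, ← Complex.exp_add]
  congr 1
  simp [inner_sub_right]
  rw [Complex.conj_ofNat]
  ring

theorem conj_char (ξ x : Plane) : starRingEnd ℂ (char ξ x) = char ξ (-x) := by
  simpa [char] using char_mul_conj ξ 0 x

/-- Fourier inversion for Schwartz functions. -/
theorem eq_integral_char (φ : 𝓢(Plane, ℂ)) (x : Plane) :
    φ x = ∫ ξ, char ξ x * (FourierTransform.fourier φ) ξ := by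
  conv_lhs => rw [← FourierTransform.fourierInv_fourier_eq (F := 𝓢(Plane, ℂ)) φ]
  rw [SchwartzMap.fourierInv_coe, Real.fourierInv_eq']
  rfl

theorem integral_char_mul_gaussian {t : ℝ} (ht : 0 < t) (x : Plane) :
    ∫ ξ, char ξ x * Real.exp (-(t * (4 * Real.pi ^ 2 * ‖ξ‖ ^ 2))) =
      ((4 * Real.pi * t)⁻¹ * Real.exp (-(‖x‖ ^ 2 / (4 * t))) : ℝ) := by
  have hb : 0 < (((4 * Real.pi ^ 2 * t : ℝ)) : ℂ).re := by
    rw [Complex.ofReal_re]; positivity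
  have h := fourier_gaussian_innerProductSpace (V := Plane) hb (-x)
  rw [Real.fourier_eq'] at h
  have hpi := Real.pi_ne_zero
  convert h using 1
  · refine integral_congr_ae (ae_of_all _ fun ξ => ?_)
    simp only [char, smul_eq_mul, inner_neg_right]
    push_cast
    congr 2 <;> ring
  · rw [finrank_euclideanSpace_fin, norm_neg]
    have : (((2 : ℕ) : ℂ) / 2) = 1 := by norm_num
    rw [this, Complex.cpow_one]
    push_cast
    have htc : (t : ℂ) ≠ 0 := by exact_mod_cast ht.ne'
    have hpc : (Real.pi : ℂ) ≠ 0 := by exact_mod_cast hpi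
    congr 1
    · field_simp
    · congr 1
      field_simp

/-! ### Fourier transforms of arcs and the heat-kernel bound. -/

section

variable {γ : ℝ → Plane} {f : ℝ → ℂ} {c N : ℝ}

theorem integrable_prod_Icc {E : Type*} [NormedAddCommGroup E] {h : ℝ × ℝ → E}
    (hh : Continuous h) (N : ℝ) :
    Integrable h ((volume.restrict (Icc (-N) N)).prod (volume.restrict (Icc (-N) N))) := by
  rw [Measure.prod_restrict]
  exact hh.continuousOn.integrableOn_compact (isCompact_Icc.prod isCompact_Icc)

theorem integrable_Icc {E : Type*} [NormedAddCommGroup E] {h : ℝ → E}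
    (hh : Continuous h) (N : ℝ) : Integrable h (volume.restrict (Icc (-N) N)) :=
  hh.continuousOn.integrableOn_compact isCompact_Icc

/-- The Fourier transform of the measure `f ds` on the arc `γ([-N, N])`. -/
noncomputable def arcFourier (γ : ℝ → Plane) (f : ℝ → ℂ) (N : ℝ) (ξ : Plane) : ℂ :=
  ∫ s in Icc (-N) N, f s * char ξ (-γ s)

theorem continuous_arcFourier (hγ : Continuous γ) (hf : Continuous f) (N : ℝ) :
    Continuous (arcFourier γ f N) := by
  refine continuous_of_dominated (bound := fun s => ‖f s‖) (fun ξ => ?_) (fun ξ => ?_) ?_ ?_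
  · exact (hf.mul (continuous_char continuous_const hγ.neg)).aestronglyMeasurable
  · refine ae_of_all _ fun s => ?_
    rw [norm_mul, norm_char, mul_one]
  · exact integrable_Icc hf.norm N
  · refine ae_of_all _ fun s => ?_
    exact continuous_const.mul (continuous_char continuous_id continuous_const)

theorem integrable_gaussian {t : ℝ} (ht : 0 < t) :
    Integrable fun ξ : Plane => Real.exp (-(t * (4 * Real.pi ^ 2 * ‖ξ‖ ^ 2))) := by
  have hb : 0 < (((4 * Real.pi ^ 2 * t : ℝ)) : ℂ).re := by
    rw [Complex.ofReal_re]; positivity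
  have := (GaussianFourier.integrable_cexp_neg_mul_sq_norm_add hb 0 (0 : Plane)).norm
  refine this.congr (ae_of_all _ fun ξ => ?_)
  simp only [Complex.norm_exp]
  congr 1
  simp
  norm_cast
  ring

theorem norm_sq_arcFourier (ξ : Plane) :
    ((‖arcFourier γ f N ξ‖ ^ 2 : ℝ) : ℂ) =
      ∫ p, f p.1 * starRingEnd ℂ (f p.2) * char ξ (γ p.2 - γ p.1)
        ∂((volume.restrict (Icc (-N) N)).prod (volume.restrict (Icc (-N) N))) := by
  rw [Complex.ofReal_pow, ← Complex.mul_conj', arcFourier, ← integral_conj, ← integral_prod_mul]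
  congr 1
  ext p
  rw [map_mul, mul_mul_mul_comm, char_mul_conj]
  congr 2
  abel

/-- By Fubini, the Gaussian weight in ξ becomes the planar heat kernel at time t between points of
the arc. -/
theorem integral_norm_sq_arcFourier_mul_gaussian (hγ : Continuous γ) (hf : Continuous f)
    {t : ℝ} (ht : 0 < t) :
    ((∫ ξ, ‖arcFourier γ f N ξ‖ ^ 2 * Real.exp (-(t * (4 * Real.pi ^ 2 * ‖ξ‖ ^ 2))) : ℝ) : ℂ) =
      ∫ p, f p.1 * starRingEnd ℂ (f p.2) *
        ((4 * Real.pi * t)⁻¹ * Real.exp (-(‖γ p.2 - γ p.1‖ ^ 2 / (4 * t))) : ℝ)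
        ∂((volume.restrict (Icc (-N) N)).prod (volume.restrict (Icc (-N) N))) := by
  set μ := (volume.restrict (Icc (-N) N)).prod (volume.restrict (Icc (-N) N))
  rw [← integral_complex_ofReal]
  simp_rw [Complex.ofReal_mul, norm_sq_arcFourier, ← integral_mul_const]
  rw [integral_integral_swap]
  · refine integral_congr_ae (ae_of_all _ fun p => ?_)
    simp only
    rw [← Complex.ofReal_mul, ← integral_char_mul_gaussian ht, ← integral_const_mul]
    simp only [mul_assoc]
  · have h1 : Integrable (fun p : ℝ × ℝ => f p.1 * starRingEnd ℂ (f p.2)) μ :=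
      integrable_prod_Icc (by fun_prop) N
    have h2 := (integrable_gaussian ht).ofReal (𝕜 := ℂ)
    have h3 := h2.mul_prod h1
    have h4 : Continuous fun q : Plane × (ℝ × ℝ) => char q.1 (γ q.2.2 - γ q.2.1) :=
      continuous_char (by fun_prop) (by fun_prop)
    refine (h3.bdd_mul (c := 1) h4.aestronglyMeasurable
      (ae_of_all _ fun q => (norm_char _ _).le)).congr (ae_of_all _ fun q => ?_)
    simp only [Function.uncurry]
    change _ * (Complex.ofReal _ * _) = _
    generalize Real.exp (-(t * (4 * Real.pi ^ 2 * ‖q.1‖ ^ 2))) = r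
    change _ * ((r : ℂ) * _) = _
    ring

/-- Schur's test for a kernel dominated by a Gaussian convolution kernel. -/
theorem integral_norm_sq_arcFourier_mul_gaussian_le (hγ : Continuous γ) (hf : Continuous f)
    (hc : 0 < c) (hcγ : ∀ s s', c * |s - s'| ≤ dist (γ s) (γ s')) {t : ℝ} (ht : 0 < t) :
    ∫ ξ, ‖arcFourier γ f N ξ‖ ^ 2 * Real.exp (-(t * (4 * Real.pi ^ 2 * ‖ξ‖ ^ 2))) ≤
      (2 * c * √Real.pi * √t)⁻¹ * ∫ s in Icc (-N) N, ‖f s‖ ^ 2 := by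
  set ν := (volume : Measure ℝ).restrict (Icc (-N) N)
  set k : ℝ → ℝ := fun r => (4 * Real.pi * t)⁻¹ * Real.exp (-(c ^ 2 / (4 * t)) * r ^ 2)
  have hkc : Continuous k := by fun_prop
  have hk0 : ∀ r, 0 ≤ k r := fun r => by positivity
  have hkint : ∫ r, k r = (2 * c * √Real.pi * √t)⁻¹ := by
    simp only [k]
    rw [integral_const_mul, integral_gaussian]
    have e : Real.pi / (c ^ 2 / (4 * t)) = (2 * √Real.pi * √t / c) ^ 2 := by
      rw [div_pow, mul_pow, mul_pow, Real.sq_sqrt Real.pi_pos.le, Real.sq_sqrt ht.le]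
      field_simp
      ring
    rw [e, Real.sqrt_sq (by positivity)]
    have h1 : √Real.pi ≠ 0 := by positivity
    have h2 : √t ≠ 0 := by positivity
    have h3 : 4 * Real.pi * t = 4 * √Real.pi ^ 2 * √t ^ 2 := by
      rw [Real.sq_sqrt Real.pi_pos.le, Real.sq_sqrt ht.le]
    rw [h3]
    field_simp
    ring
  have hkI : Integrable k :=
    (integrable_exp_neg_mul_sq (by positivity : 0 < c ^ 2 / (4 * t))).const_mul _
  have hk1 : ∀ s, ∫ s', k (s - s') ∂ν ≤ (2 * c * √Real.pi * √t)⁻¹ := by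
    intro s
    rw [← hkint, ← integral_sub_left_eq_self k volume s]
    exact setIntegral_le_integral (hkI.comp_sub_left s) (ae_of_all _ fun s' => hk0 _)
  have hsymm : ∀ r s, k (r - s) = k (s - r) := fun r s => by
    simp only [k]; ring_nf
  have hhalf : ∫ p, ‖f p.1‖ ^ 2 * k (p.1 - p.2) ∂(ν.prod ν) ≤
      (2 * c * √Real.pi * √t)⁻¹ * ∫ s, ‖f s‖ ^ 2 ∂ν := by
    rw [integral_prod _ (integrable_prod_Icc (by fun_prop) N), ← integral_const_mul]
    refine integral_mono_of_nonneg (ae_of_all _ fun s => ?_)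
      ((integrable_Icc (by fun_prop) N).const_mul _) (ae_of_all _ fun s => ?_)
    · exact integral_nonneg fun s' => mul_nonneg (by positivity) (hk0 _)
    · simp only
      rw [integral_const_mul, mul_comm]
      gcongr
      exact hk1 s
  have hhalf' : ∫ p, ‖f p.2‖ ^ 2 * k (p.1 - p.2) ∂(ν.prod ν) =
      ∫ p, ‖f p.1‖ ^ 2 * k (p.1 - p.2) ∂(ν.prod ν) := by
    rw [← integral_prod_swap]
    refine integral_congr_ae (ae_of_all _ fun p => ?_)
    simp only [Prod.fst_swap, Prod.snd_swap]
    rw [hsymm]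
  have h0 : 0 ≤ ∫ ξ, ‖arcFourier γ f N ξ‖ ^ 2 * Real.exp (-(t * (4 * Real.pi ^ 2 * ‖ξ‖ ^ 2))) :=
    integral_nonneg fun ξ => by positivity
  rw [← Real.norm_of_nonneg h0, ← Complex.norm_real,
    integral_norm_sq_arcFourier_mul_gaussian hγ hf ht]
  have hb : ∀ p : ℝ × ℝ, ‖f p.1 * starRingEnd ℂ (f p.2) *
        ((4 * Real.pi * t)⁻¹ * Real.exp (-(‖γ p.2 - γ p.1‖ ^ 2 / (4 * t))) : ℝ)‖ ≤
      2⁻¹ * (‖f p.1‖ ^ 2 * k (p.1 - p.2) + ‖f p.2‖ ^ 2 * k (p.1 - p.2)) := by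
    intro p
    -- The heat kernel decreases with distance, so the chord-arc bound dominates it by a function of
    -- s - s' alone.
    have h1 : (4 * Real.pi * t)⁻¹ * Real.exp (-(‖γ p.2 - γ p.1‖ ^ 2 / (4 * t))) ≤
        k (p.1 - p.2) := by
      simp only [k]
      gcongr
      have := hcγ p.2 p.1
      rw [dist_eq_norm, abs_sub_comm] at this
      have h2 : (c * |p.1 - p.2|) ^ 2 ≤ ‖γ p.2 - γ p.1‖ ^ 2 := by gcongr
      rw [mul_pow, sq_abs] at h2
      rw [neg_mul, neg_le_neg_iff, div_mul_eq_mul_div]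
      gcongr
    rw [norm_mul, norm_mul, RCLike.norm_conj, Complex.norm_real,
      Real.norm_of_nonneg (by positivity)]
    have h3 := two_mul_le_add_sq ‖f p.1‖ ‖f p.2‖
    calc _ ≤ ‖f p.1‖ * ‖f p.2‖ * k (p.1 - p.2) := by gcongr
      _ ≤ _ := by nlinarith [hk0 (p.1 - p.2)]
  have hi1 : Integrable (fun p : ℝ × ℝ => ‖f p.1‖ ^ 2 * k (p.1 - p.2)) (ν.prod ν) :=
    integrable_prod_Icc (by fun_prop) N
  have hi2 : Integrable (fun p : ℝ × ℝ => ‖f p.2‖ ^ 2 * k (p.1 - p.2)) (ν.prod ν) :=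
    integrable_prod_Icc (by fun_prop) N
  refine (norm_integral_le_of_norm_le ((hi1.add hi2).const_mul 2⁻¹) (ae_of_all _ hb)).trans ?_
  simp only [Pi.add_apply]
  rw [integral_const_mul, integral_add hi1 hi2, hhalf']
  linarith

/-! ### From the heat kernel to the resolvent kernel by integration in time. -/

theorem lintegral_exp_neg_mul {a : ℝ} (ha : 0 < a) :
    ∫⁻ t in Ioi (0 : ℝ), ENNReal.ofReal (Real.exp (-(t * a))) = ENNReal.ofReal a⁻¹ := by
  have hi : IntegrableOn (fun t : ℝ => Real.exp (-(t * a))) (Ioi 0) := by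
    simpa [mul_comm] using integrableOn_exp_mul_Ioi (neg_neg_of_pos ha) 0
  rw [← ofReal_integral_eq_lintegral_ofReal hi (ae_of_all _ fun t => by positivity)]
  congr 1
  have := integral_exp_mul_Ioi (neg_neg_of_pos ha) 0
  simp only [mul_zero, Real.exp_zero] at this
  rw [← neg_div_neg_eq, neg_neg, neg_neg] at this
  rw [inv_eq_one_div, ← this]
  congr 1
  ext t
  ring_nf

theorem lintegral_exp_neg_mul_sqrt_inv {κ : ℝ} (hκ : 0 < κ) :
    ∫⁻ t in Ioi (0 : ℝ), ENNReal.ofReal (Real.exp (-(t * κ ^ 2)) * (√t)⁻¹) =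
      ENNReal.ofReal (√Real.pi / κ) := by
  have h := Real.integral_rpow_mul_exp_neg_mul_Ioi (a := 1 / 2) (r := κ ^ 2) (by norm_num)
    (by positivity)
  have e : ∀ t ∈ Ioi (0 : ℝ), t ^ ((1 : ℝ) / 2 - 1) * Real.exp (-(κ ^ 2 * t)) =
      Real.exp (-(t * κ ^ 2)) * (√t)⁻¹ := by
    intro t ht
    rw [mul_comm, mul_comm t, Real.sqrt_eq_rpow, ← Real.rpow_neg (le_of_lt ht)]
    norm_num
  rw [setIntegral_congr_fun measurableSet_Ioi e, Real.Gamma_one_half_eq, one_div,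
    ← Real.sqrt_eq_rpow, Real.sqrt_inv, Real.sqrt_sq hκ.le] at h
  have hi : IntegrableOn (fun t => Real.exp (-(t * κ ^ 2)) * (√t)⁻¹) (Ioi 0) := by
    -- A non-integrable function would have integral 0 by convention, contradicting the positive
    -- Gamma value in `h`.
    by_contra hn
    rw [integral_undef hn] at h
    have : 0 < κ⁻¹ * √Real.pi := by positivity
    linarith
  rw [← ofReal_integral_eq_lintegral_ofReal hi (ae_of_all _ fun t => by positivity), h]
  congr 1
  ring

/-- Use 1/a = ∫₀^∞ e^{-ta} dt and Tonelli, then the Schur bound at each t. Working with `lintegral`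
makes finiteness of the left side part of the conclusion. -/
theorem lintegral_norm_sq_arcFourier_div_le (hγ : Continuous γ) (hf : Continuous f)
    (hc : 0 < c) (hcγ : ∀ s s', c * |s - s'| ≤ dist (γ s) (γ s')) {κ : ℝ} (hκ : 0 < κ) :
    ∫⁻ ξ, ENNReal.ofReal (‖arcFourier γ f N ξ‖ ^ 2 * (4 * Real.pi ^ 2 * ‖ξ‖ ^ 2 + κ ^ 2)⁻¹) ≤
      ENNReal.ofReal ((2 * c * κ)⁻¹ * ∫ s in Icc (-N) N, ‖f s‖ ^ 2) := by
  have hFc := continuous_arcFourier hγ hf N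
  set A := ∫ s in Icc (-N) N, ‖f s‖ ^ 2
  have hA : 0 ≤ A := integral_nonneg fun s => by positivity
  calc ∫⁻ ξ, ENNReal.ofReal (‖arcFourier γ f N ξ‖ ^ 2 * (4 * Real.pi ^ 2 * ‖ξ‖ ^ 2 + κ ^ 2)⁻¹)
      = ∫⁻ ξ, ∫⁻ t in Ioi (0 : ℝ), ENNReal.ofReal (‖arcFourier γ f N ξ‖ ^ 2 *
          Real.exp (-(t * (4 * Real.pi ^ 2 * ‖ξ‖ ^ 2 + κ ^ 2)))) := by
        refine lintegral_congr fun ξ => ?_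
        rw [ENNReal.ofReal_mul (by positivity), ← lintegral_exp_neg_mul (by positivity),
          ← lintegral_const_mul' _ _ ENNReal.ofReal_ne_top]
        refine lintegral_congr fun t => ?_
        rw [ENNReal.ofReal_mul (by positivity)]
    _ = ∫⁻ t in Ioi (0 : ℝ), ∫⁻ ξ, ENNReal.ofReal (‖arcFourier γ f N ξ‖ ^ 2 *
          Real.exp (-(t * (4 * Real.pi ^ 2 * ‖ξ‖ ^ 2 + κ ^ 2)))) := by
        refine lintegral_lintegral_swap (Measurable.aemeasurable ?_)
        refine ENNReal.measurable_ofReal.comp (Continuous.measurable ?_)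
        fun_prop
    _ ≤ ∫⁻ t in Ioi (0 : ℝ), ENNReal.ofReal ((2 * c * √Real.pi)⁻¹ * A) *
          ENNReal.ofReal (Real.exp (-(t * κ ^ 2)) * (√t)⁻¹) := by
        refine setLIntegral_mono' measurableSet_Ioi fun t ht => ?_
        have ht : 0 < t := ht
        have hle := integral_norm_sq_arcFourier_mul_gaussian_le (N := N) hγ hf hc hcγ ht
        have hi : Integrable fun ξ => ‖arcFourier γ f N ξ‖ ^ 2 *
            Real.exp (-(t * (4 * Real.pi ^ 2 * ‖ξ‖ ^ 2))) := by
          refine (integrable_gaussian ht).bdd_mul (c := (∫ s in Icc (-N) N, ‖f s‖) ^ 2)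
            (by fun_prop) (ae_of_all _ fun ξ => ?_)
          rw [norm_pow, norm_norm]
          gcongr
          refine (norm_integral_le_integral_norm _).trans (le_of_eq ?_)
          simp_rw [norm_mul, norm_char, mul_one]
        have e : ∀ ξ, ‖arcFourier γ f N ξ‖ ^ 2 *
            Real.exp (-(t * (4 * Real.pi ^ 2 * ‖ξ‖ ^ 2 + κ ^ 2))) =
            Real.exp (-(t * κ ^ 2)) * (‖arcFourier γ f N ξ‖ ^ 2 *
              Real.exp (-(t * (4 * Real.pi ^ 2 * ‖ξ‖ ^ 2)))) := by
          intro ξ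
          rw [mul_left_comm, ← Real.exp_add]
          ring_nf
        simp_rw [e]
        rw [← ofReal_integral_eq_lintegral_ofReal (hi.const_mul _)
          (ae_of_all _ fun ξ => by positivity), integral_const_mul,
          ← ENNReal.ofReal_mul (by positivity)]
        refine ENNReal.ofReal_le_ofReal ?_
        calc _ ≤ Real.exp (-(t * κ ^ 2)) * ((2 * c * √Real.pi * √t)⁻¹ * A) := by gcongr
          _ = _ := by rw [mul_inv _ (√t)]; ring
    _ = _ := by
        rw [lintegral_const_mul' _ _ ENNReal.ofReal_ne_top, lintegral_exp_neg_mul_sqrt_inv hκ,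
          ← ENNReal.ofReal_mul (by positivity)]
        congr 1
        have : √Real.pi ≠ 0 := by positivity
        field_simp

/-! ### Plancherel and duality: the trace inequality for Schwartz functions. -/

theorem norm_sq_fourier_lineDeriv (φ : 𝓢(Plane, ℂ)) (j : Fin 2) (ξ : Plane) :
    ‖(FourierTransform.fourier (∂_{unitVec j} φ : 𝓢(Plane, ℂ))) ξ‖ ^ 2 =
      4 * Real.pi ^ 2 * (ξ j) ^ 2 * ‖(FourierTransform.fourier φ) ξ‖ ^ 2 := by
  have h : (inner ℝ · (unitVec j) : Plane → ℝ).HasTemperateGrowth := by fun_prop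
  rw [SchwartzMap.fourier_lineDerivOp_eq, smul_apply,
    SchwartzMap.smulLeftCLM_apply_apply h, EuclideanSpace.inner_single_right]
  simp only [norm_smul, norm_mul, mul_pow, Complex.norm_I, Complex.norm_real, Complex.norm_ofNat]
  simp
  ring

theorem integral_norm_sq_fourier_mul (φ : 𝓢(Plane, ℂ)) (κ : ℝ) :
    Integrable (fun ξ => (4 * Real.pi ^ 2 * ‖ξ‖ ^ 2 + κ ^ 2) *
      ‖(FourierTransform.fourier φ) ξ‖ ^ 2) ∧
    ∫ ξ, (4 * Real.pi ^ 2 * ‖ξ‖ ^ 2 + κ ^ 2) * ‖(FourierTransform.fourier φ) ξ‖ ^ 2 =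
      ∑ j, (∫ x, ‖(∂_{unitVec j} φ : 𝓢(Plane, ℂ)) x‖ ^ 2) + κ ^ 2 * ∫ x, ‖φ x‖ ^ 2 := by
  have hI : ∀ ψ : 𝓢(Plane, ℂ), Integrable fun ξ => ‖ψ ξ‖ ^ 2 := fun ψ =>
    (memLp_two_iff_integrable_sq_norm ψ.continuous.aestronglyMeasurable).1 (ψ.memLp 2 volume)
  have e : ∀ ξ : Plane, (4 * Real.pi ^ 2 * ‖ξ‖ ^ 2 + κ ^ 2) * ‖(FourierTransform.fourier φ) ξ‖ ^ 2 =
      ∑ j, ‖(FourierTransform.fourier (∂_{unitVec j} φ : 𝓢(Plane, ℂ))) ξ‖ ^ 2 +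
      κ ^ 2 * ‖(FourierTransform.fourier φ) ξ‖ ^ 2 := by
    intro ξ
    simp only [norm_sq_fourier_lineDeriv, EuclideanSpace.real_norm_sq_eq, Fin.sum_univ_two]
    ring
  simp_rw [e]
  have h1 : Integrable fun ξ => ∑ j,
      ‖(FourierTransform.fourier (∂_{unitVec j} φ : 𝓢(Plane, ℂ))) ξ‖ ^ 2 :=
    integrable_finsetSum _ fun j _ => hI _
  have h2 := (hI (FourierTransform.fourier φ)).const_mul (κ ^ 2)
  refine ⟨h1.add h2, ?_⟩
  rw [integral_add h1 h2, integral_finsetSum _ fun j _ => hI _, integral_const_mul]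
  simp_rw [SchwartzMap.integral_norm_sq_fourier]

/-- The sharp trace inequality for a curve with chord-arc constant at least `c`. -/
theorem setIntegral_norm_sq_comp_le (hγ : Continuous γ)
    (hc : 0 < c) (hcγ : ∀ s s', c * |s - s'| ≤ dist (γ s) (γ s')) {κ : ℝ} (hκ : 0 < κ)
    (φ : 𝓢(Plane, ℂ)) (N : ℝ) :
    2 * c * κ * ∫ s in Icc (-N) N, ‖φ (γ s)‖ ^ 2 ≤
      ∑ j, (∫ x, ‖(∂_{unitVec j} φ : 𝓢(Plane, ℂ)) x‖ ^ 2) + κ ^ 2 * ∫ x, ‖φ x‖ ^ 2 := by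
  set ψ := FourierTransform.fourier φ with hψ
  set f : ℝ → ℂ := fun s => φ (γ s) with hfdef
  have hf : Continuous f := φ.continuous.comp hγ
  set F := arcFourier γ f N with hF
  have hFc : Continuous F := continuous_arcFourier hγ hf N
  set A := ∫ s in Icc (-N) N, ‖f s‖ ^ 2
  have hA : 0 ≤ A := integral_nonneg fun s => by positivity
  obtain ⟨hQi, hQ⟩ := integral_norm_sq_fourier_mul φ κ
  set W : Plane → ℝ := fun ξ => 4 * Real.pi ^ 2 * ‖ξ‖ ^ 2 + κ ^ 2
  have hW : ∀ ξ, 0 < W ξ := fun ξ => by positivity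
  have hle := lintegral_norm_sq_arcFourier_div_le (N := N) hγ hf hc hcγ hκ
  have hnn : 0 ≤ᵐ[volume] fun ξ => ‖F ξ‖ ^ 2 * (W ξ)⁻¹ :=
    ae_of_all _ fun ξ => mul_nonneg (by positivity) (inv_nonneg.2 (hW ξ).le)
  have hWc : Continuous fun ξ => (W ξ)⁻¹ :=
    Continuous.inv₀ (by fun_prop) fun ξ => (hW ξ).ne'
  have hFi : Integrable fun ξ => ‖F ξ‖ ^ 2 * (W ξ)⁻¹ := by
    refine ⟨by fun_prop, ?_⟩
    rw [hasFiniteIntegral_iff_ofReal hnn]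
    exact hle.trans_lt ENNReal.ofReal_lt_top
  have hFle : ∫ ξ, ‖F ξ‖ ^ 2 * (W ξ)⁻¹ ≤ (2 * c * κ)⁻¹ * A := by
    rw [← ofReal_integral_eq_lintegral_ofReal hFi hnn] at hle
    exact (ENNReal.ofReal_le_ofReal_iff (by positivity)).1 hle
  -- Fourier inversion of φ at the points γ(s) turns the L² mass on the arc into a pairing of φ̂
  -- with F.
  have hAF : (A : ℂ) = ∫ ξ, ψ ξ * starRingEnd ℂ (F ξ) := by
    have e1 : ∀ ξ, ψ ξ * starRingEnd ℂ (F ξ) =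
        ∫ s in Icc (-N) N, ψ ξ * (starRingEnd ℂ (f s) * char ξ (γ s)) := by
      intro ξ
      rw [integral_const_mul, hF, arcFourier, ← integral_conj]
      simp_rw [map_mul, conj_char, neg_neg]
    simp_rw [e1]
    rw [integral_integral_swap]
    · rw [← integral_complex_ofReal]
      refine integral_congr_ae (ae_of_all _ fun s => ?_)
      simp only
      rw [Complex.ofReal_pow, ← Complex.conj_mul']
      have e2 : f s = ∫ ξ, char ξ (γ s) * ψ ξ := eq_integral_char φ (γ s)
      conv_lhs => enter [2]; rw [e2]
      rw [← integral_const_mul]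
      refine integral_congr_ae (ae_of_all _ fun ξ => ?_)
      simp only
      ring
    · have h1 : Integrable (fun s => starRingEnd ℂ (f s)) (volume.restrict (Icc (-N) N)) :=
        integrable_Icc (by fun_prop) N
      have h3 := (ψ.integrable (μ := volume)).mul_prod h1
      have h4 : Continuous fun q : Plane × ℝ => char q.1 (γ q.2) :=
        continuous_char (by fun_prop) (by fun_prop)
      refine (h3.bdd_mul (c := 1) h4.aestronglyMeasurable
        (ae_of_all _ fun q => (norm_char _ _).le)).congr (ae_of_all _ fun q => ?_)
      simp only [Function.uncurry]
      ring
  have hA2 : A ≤ ∫ ξ, 2⁻¹ * ((2 * c * κ)⁻¹ * (W ξ * ‖ψ ξ‖ ^ 2) +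
      2 * c * κ * (‖F ξ‖ ^ 2 * (W ξ)⁻¹)) := by
    rw [← Real.norm_of_nonneg hA, ← Complex.norm_real, hAF]
    refine norm_integral_le_of_norm_le
      (((hQi.const_mul _).add (hFi.const_mul _)).const_mul _) (ae_of_all _ fun ξ => ?_)
    rw [norm_mul, RCLike.norm_conj]
    have hw := hW ξ
    have hd : 0 < 2 * c * κ := by positivity
    -- Weighted Young inequality; the two weights are reciprocal, so their square roots multiply to
    -- 1.
    have h := two_mul_le_add_sq (√((2 * c * κ)⁻¹ * W ξ) * ‖ψ ξ‖)
      (√(2 * c * κ * (W ξ)⁻¹) * ‖F ξ‖)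
    have hs : √((2 * c * κ)⁻¹ * W ξ) * √(2 * c * κ * (W ξ)⁻¹) = 1 := by
      rw [← Real.sqrt_mul (by positivity)]
      rw [show (2 * c * κ)⁻¹ * W ξ * (2 * c * κ * (W ξ)⁻¹) = 1 by
        have := hw.ne'; field_simp]
      exact Real.sqrt_one
    rw [mul_pow, mul_pow, Real.sq_sqrt (by positivity), Real.sq_sqrt (by positivity)] at h
    have h' : 2 * (‖ψ ξ‖ * ‖F ξ‖) ≤ _ := le_trans (le_of_eq (by
      linear_combination (-2 * ‖ψ ξ‖ * ‖F ξ‖) * hs)) h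
    linarith
  rw [integral_const_mul, integral_add (hQi.const_mul _) (hFi.const_mul _), integral_const_mul,
    integral_const_mul, hQ] at hA2
  have hd : 0 < 2 * c * κ := by positivity
  have h5 : 2 * c * κ * ∫ ξ, ‖F ξ‖ ^ 2 * (W ξ)⁻¹ ≤ A := by
    calc _ ≤ 2 * c * κ * ((2 * c * κ)⁻¹ * A) := by gcongr
      _ = A := by field_simp
  -- The F-term in `hA2` is at most A/2 by `h5`, so it is absorbed into the left side.
  have h6 : A ≤ (2 * c * κ)⁻¹ * (∑ j, (∫ x, ‖(∂_{unitVec j} φ : 𝓢(Plane, ℂ)) x‖ ^ 2) +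
      κ ^ 2 * ∫ x, ‖φ x‖ ^ 2) := by linarith
  rwa [inv_mul_eq_div, le_div_iff₀' hd] at h6

end

/-! ### Geometry of the curve -/

/-- The break points are countable, so the fundamental theorem of calculus off a countable set
applies to the continuous γ with unit speed elsewhere. -/
theorem IsInfiniteCurve.lipschitzWith {γ : ℝ → Plane} (hγ : IsInfiniteCurve γ) :
    LipschitzWith 1 γ := by
  obtain ⟨B, hB, -, hd⟩ := hγ.piecewise
  have hBc : B.Countable := by
    have : B = ⋃ n : ℕ, B ∩ Icc (-(n : ℝ)) n := by
      rw [← inter_iUnion, eq_comm, inter_eq_left]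
      intro x _
      obtain ⟨n, hn⟩ := exists_nat_ge |x|
      exact mem_iUnion.2 ⟨n, abs_le.1 hn⟩
    rw [this]
    exact countable_iUnion fun n => (hB n).countable
  have hdiff : ∀ s, s ∉ B → HasDerivAt γ (deriv γ s) s := fun s hs => by
    -- `deriv` is 0 at points of non-differentiability, so unit speed forces differentiability.
    refine (differentiableAt_of_deriv_ne_zero fun h0 => ?_).hasDerivAt
    have := hd s hs
    rw [h0, norm_zero] at this
    exact zero_ne_one this
  have hbound : ∀ᵐ s : ℝ, ‖deriv γ s‖ ≤ 1 := by
    filter_upwards [hBc.ae_notMem volume] with s hs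
    exact (hd s hs).le
  refine LipschitzWith.of_dist_le_mul fun a b => ?_
  have hint : IntervalIntegrable (deriv γ) volume b a := by
    refine (intervalIntegrable_const (c := (1 : ℝ))).mono_fun
      (measurable_deriv γ).aestronglyMeasurable (ae_restrict_of_ae ?_)
    simpa using hbound
  have h := MeasureTheory.integral_eq_of_hasDerivAt_off_countable γ (deriv γ) hBc
    hγ.continuous.continuousOn (fun x hx => hdiff x hx.2) hint
  rw [dist_eq_norm, ← h, Real.dist_eq, NNReal.coe_one]
  refine intervalIntegral.norm_integral_le_of_norm_le_const_ae ?_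
  filter_upwards [hbound] with s hs _ using hs

theorem chordArc_mul_le {γ : ℝ → Plane} (s s' : ℝ) :
    chordArc γ * |s - s'| ≤ dist (γ s) (γ s') := by
  rcases eq_or_ne s s' with rfl | hne
  · simp
  · rw [← le_div_iff₀ (abs_pos.2 (sub_ne_zero.2 hne))]
    refine ciInf_le (f := fun p : {p : ℝ × ℝ // p.1 ≠ p.2} =>
      dist (γ p.1.1) (γ p.1.2) / |p.1.1 - p.1.2|) ⟨0, ?_⟩ ⟨(s, s'), hne⟩
    rintro _ ⟨p, rfl⟩
    positivity

/-- A 1-Lipschitz map does not increase one-dimensional Hausdorff measure. This one-sided comparison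
suffices for an upper bound on the trace. -/
theorem curveMeasure_le_map {γ : ℝ → Plane} (hγ : LipschitzWith 1 γ) :
    curveMeasure γ ≤ Measure.map γ volume := by
  refine Measure.le_iff.2 fun M hM => ?_
  rw [curveMeasure, Measure.restrict_apply hM, Measure.map_apply hγ.continuous.measurable hM,
    ← image_preimage_eq_inter_range]
  have := hγ.hausdorffMeasure_image_le (d := 1) zero_le_one (γ ⁻¹' M)
  rwa [ENNReal.coe_one, ENNReal.one_rpow, one_mul,
    hausdorffMeasure_real] at this

/-- The chord-arc bound makes |γ(s)| grow at least linearly, so (1 + |γ(s)|)⁻² is integrable in s.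
-/
theorem hasTemperateGrowth_map {γ : ℝ → Plane} (hγ : Continuous γ) {c : ℝ} (hc : 0 < c)
    (hcγ : ∀ s s', c * |s - s'| ≤ dist (γ s) (γ s')) :
    (Measure.map γ (volume : Measure ℝ)).HasTemperateGrowth := by
  refine ⟨2, ?_⟩
  have hm : Continuous fun x : Plane => (1 + ‖x‖) ^ (-((2 : ℕ) : ℝ)) :=
    Continuous.rpow_const (by fun_prop) fun x => Or.inl (by positivity)
  rw [integrable_map_measure hm.aestronglyMeasurable hγ.measurable.aemeasurable]
  set K := 1 + ‖γ 0‖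
  have hK : 1 ≤ K := by simp [K]
  have hk : ∀ s : ℝ, 1 + c ^ 2 * s ^ 2 ≤ (2 * K ^ 2) * (1 + ‖γ s‖) ^ 2 := by
    intro s
    have h1 := hcγ s 0
    rw [sub_zero, dist_eq_norm] at h1
    have h2 : c * |s| ≤ ‖γ s‖ + ‖γ 0‖ := h1.trans (norm_sub_le _ _)
    have h3 : (c * |s|) ^ 2 ≤ (‖γ s‖ + ‖γ 0‖) ^ 2 := by gcongr
    rw [mul_pow, sq_abs] at h3
    have h4 : ‖γ s‖ + ‖γ 0‖ ≤ K * (1 + ‖γ s‖) := by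
      simp only [K]; nlinarith [norm_nonneg (γ s), norm_nonneg (γ 0)]
    have h5 : (‖γ s‖ + ‖γ 0‖) ^ 2 ≤ (K * (1 + ‖γ s‖)) ^ 2 := by gcongr
    have h6 : 1 ≤ (K * (1 + ‖γ s‖)) ^ 2 :=
      one_le_pow₀ (one_le_mul_of_one_le_of_one_le hK (by simp))
    nlinarith
  have hI : Integrable fun s : ℝ => (2 * K ^ 2) * (1 + (c * s) ^ 2)⁻¹ :=
    (integrable_inv_one_add_sq.comp_mul_left' hc.ne').const_mul _
  refine hI.mono' (hm.comp hγ).aestronglyMeasurable (ae_of_all _ fun s => ?_)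
  simp only [Function.comp_apply]
  rw [Real.norm_of_nonneg (by positivity), Real.rpow_neg (by positivity), Real.rpow_natCast,
    mul_pow, ← div_eq_mul_inv, le_div_iff₀ (by positivity), inv_mul_le_iff₀ (by positivity),
    mul_comm _ (2 * K ^ 2)]
  exact hk s

theorem hasTemperateGrowth_curveMeasure {γ : ℝ → Plane} (hγ : LipschitzWith 1 γ)
    (hc : 0 < chordArc γ) : (curveMeasure γ).HasTemperateGrowth := by
  obtain ⟨n, hn⟩ := (hasTemperateGrowth_map hγ.continuous hc chordArc_mul_le).exists_integrable
  exact ⟨n, hn.mono_measure (curveMeasure_le_map hγ)⟩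

/-- The sharp trace inequality on the curve, for Schwartz functions. -/
theorem integral_norm_sq_curveMeasure_le {γ : ℝ → Plane} (hγ : LipschitzWith 1 γ)
    (hc : 0 < chordArc γ) {κ : ℝ} (hκ : 0 < κ) (φ : 𝓢(Plane, ℂ)) :
    2 * chordArc γ * κ * ∫ x, ‖φ x‖ ^ 2 ∂(curveMeasure γ) ≤
      ∑ j, (∫ x, ‖(∂_{unitVec j} φ : 𝓢(Plane, ℂ)) x‖ ^ 2) + κ ^ 2 * ∫ x, ‖φ x‖ ^ 2 := by
  have := hasTemperateGrowth_map hγ.continuous hc chordArc_mul_le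
  have hI : Integrable (fun x => ‖φ x‖ ^ 2) (Measure.map γ volume) :=
    (memLp_two_iff_integrable_sq_norm φ.continuous.aestronglyMeasurable).1 (φ.memLp 2 _)
  have h1 : ∫ x, ‖φ x‖ ^ 2 ∂(curveMeasure γ) ≤ ∫ s, ‖φ (γ s)‖ ^ 2 := by
    rw [← integral_map (φ := γ) hγ.continuous.measurable.aemeasurable hI.aestronglyMeasurable]
    exact integral_mono_measure (curveMeasure_le_map hγ) (ae_of_all _ fun x => by positivity) hI
  have hI' : Integrable fun s => ‖φ (γ s)‖ ^ 2 :=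
    (integrable_map_measure hI.aestronglyMeasurable hγ.continuous.measurable.aemeasurable).1 hI
  have hlim : Tendsto (fun n : ℕ => ∫ s in Icc (-(n : ℝ)) n, ‖φ (γ s)‖ ^ 2) atTop
      (𝓝 (∫ s, ‖φ (γ s)‖ ^ 2)) := by
    have h := tendsto_setIntegral_of_monotone (μ := volume) (s := fun n : ℕ => Icc (-(n : ℝ)) n)
      (f := fun s => ‖φ (γ s)‖ ^ 2) (fun n => measurableSet_Icc)
      (fun m n hmn => Icc_subset_Icc (by simpa using hmn) (by simpa using hmn))
      (hI'.integrableOn)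
    have hU : ⋃ n : ℕ, Icc (-(n : ℝ)) n = univ := by
      refine eq_univ_of_forall fun x => ?_
      obtain ⟨n, hn⟩ := exists_nat_ge |x|
      exact mem_iUnion.2 ⟨n, abs_le.1 hn⟩
    rwa [hU, setIntegral_univ] at h
  refine le_trans (by gcongr) (le_of_tendsto (hlim.const_mul (2 * chordArc γ * κ))
    (Eventually.of_forall fun n =>
      setIntegral_norm_sq_comp_le hγ.continuous hc chordArc_mul_le hκ φ n))

/-! ### Extension of the trace inequality to H¹. -/

theorem norm_sq_toLp {ν : Measure Plane} [ν.HasTemperateGrowth] (φ : 𝓢(Plane, ℂ)) :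
    ‖φ.toLp 2 ν‖ ^ 2 = ∫ x, ‖φ x‖ ^ 2 ∂ν := by
  rw [@norm_sq_eq_re_inner ℂ, MeasureTheory.L2.inner_def, ← integral_re (L2.integrable_inner _ _)]
  refine integral_congr_ae ?_
  filter_upwards [φ.coeFn_toLp 2 ν] with x hx
  rw [hx, inner_self_eq_norm_sq]

theorem trace_schwartz_le {γ : ℝ → Plane} (hγ : LipschitzWith 1 γ)
    (hc : 0 < chordArc γ) {κ : ℝ} (hκ : 0 < κ) (φ : 𝓢(Plane, ℂ)) :
    2 * chordArc γ * κ * ‖restrictSchwartz (curveMeasure γ) φ‖ ^ 2 ≤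
      ∑ j, ‖partialDeriv j (schwartzToH1 φ)‖ ^ 2 + κ ^ 2 * ‖toL2 (schwartzToH1 φ)‖ ^ 2 := by
  have := hasTemperateGrowth_curveMeasure hγ hc
  have h1 : restrictSchwartz (curveMeasure γ) φ = φ.toLp 2 (curveMeasure γ) := by
    rw [restrictSchwartz, dif_pos this]
    rfl
  have h2 : toL2 (schwartzToH1 φ) = φ.toLp 2 := rfl
  have h3 : ∀ j, partialDeriv j (schwartzToH1 φ) = (∂_{unitVec j} φ : 𝓢(Plane, ℂ)).toLp 2 :=
    fun j => rfl
  simp only [h1, h2, h3, norm_sq_toLp]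
  exact integral_norm_sq_curveMeasure_le hγ hc hκ φ

theorem restrictSchwartz_bounded {γ : ℝ → Plane} (hγ : LipschitzWith 1 γ)
    (hc : 0 < chordArc γ) :
    ∃ C, ∀ φ, ‖restrictSchwartz (curveMeasure γ) φ‖ ≤ C * ‖schwartzToH1 φ‖ := by
  refine ⟨√(2 * chordArc γ)⁻¹, fun φ => ?_⟩
  have h := trace_schwartz_le hγ hc one_pos φ
  rw [mul_one, one_pow, one_mul, add_comm, ← norm_sq_eq, ← le_inv_mul_iff₀ (by positivity)] at h
  have := Real.sqrt_le_sqrt h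
  rwa [Real.sqrt_sq (norm_nonneg _), Real.sqrt_mul (by positivity),
    Real.sqrt_sq (norm_nonneg _)] at this

/-- The sharp trace inequality on `H¹(ℝ²)`. -/
theorem trace_le {γ : ℝ → Plane} (hγ : LipschitzWith 1 γ)
    (hc : 0 < chordArc γ) {κ : ℝ} (hκ : 0 < κ) (w : H1) :
    2 * chordArc γ * κ * ‖trace (curveMeasure γ) w‖ ^ 2 ≤
      ∑ j, ‖partialDeriv j w‖ ^ 2 + κ ^ 2 * ‖toL2 w‖ ^ 2 := by
  refine denseRange_schwartzToH1.induction_on (p := fun w : H1 =>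
    2 * chordArc γ * κ * ‖trace (curveMeasure γ) w‖ ^ 2 ≤
      ∑ j, ‖partialDeriv j w‖ ^ 2 + κ ^ 2 * ‖toL2 w‖ ^ 2) w ?_ fun φ => ?_
  · have h1 : Continuous fun w : H1 => toL2 w := toL2CLM.continuous
    have h2 : ∀ j, Continuous fun w : H1 => partialDeriv j w := fun j =>
      (partialDerivCLM j).continuous
    have h3 := (trace (curveMeasure γ)).continuous
    exact isClosed_le (continuous_const.mul (h3.norm.pow 2))
      ((continuous_finsetSum _ fun j _ => (h2 j).norm.pow 2).add
        (continuous_const.mul (h1.norm.pow 2)))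
  · rw [trace, LinearMap.extendOfNorm_eq denseRange_schwartzToH1 (restrictSchwartz_bounded hγ hc)]
    exact trace_schwartz_le hγ hc hκ φ

/-! ### The spectral lower bound. -/

/-- The spectrum of `-Δ - α δ(· - Γ)` lies to the right of `-α² / (4 c(Γ)²)`. -/
theorem le_re_of_mem_spec_hamiltonian {α : ℝ} (hα : 0 < α) {γ : ℝ → Plane}
    (hγ : LipschitzWith 1 γ) (hc : 0 < chordArc γ) {z : ℂ} (hz : z ∈ spec (hamiltonian α γ)) :
    -(α ^ 2 / (4 * chordArc γ ^ 2)) ≤ z.re := by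
  by_contra! hlt
  set c := chordArc γ
  set κ₀ := α / (2 * c) with hκ₀
  have hκ₀p : 0 < κ₀ := by positivity
  have hz' : κ₀ ^ 2 < -z.re := by
    have : κ₀ ^ 2 = α ^ 2 / (4 * c ^ 2) := by rw [hκ₀, div_pow]; ring
    linarith
  -- a number `κ` with `κ₀ < κ` and `κ₀ κ < -z.re`
  set κ := (κ₀ + -z.re / κ₀) / 2 with hκ
  have hk1 : κ₀ < -z.re / κ₀ := by rw [lt_div_iff₀ hκ₀p]; linarith [sq κ₀]
  have hk2 : κ₀ < κ := by linarith
  have hk3 : κ₀ * κ < -z.re := by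
    have : κ < -z.re / κ₀ := by linarith
    rw [lt_div_iff₀ hκ₀p] at this
    linarith
  have hκp : 0 < κ := hκ₀p.trans hk2
  -- The trace inequality at κ bounds α‖I_Γ w‖² by θ times its right side. Since κ > κ₀, a fraction
  -- 1 - θ of the gradient term survives, as H¹ coercivity requires; κ = κ₀ would leave none.
  set θ := κ₀ / κ with hθ
  have hθ1 : θ < 1 := (div_lt_one hκp).2 hk2
  have hδ : 0 < min (1 - θ) (-z.re - κ₀ * κ) := lt_min (by linarith) (by linarith)
  refine notMem_spec_formOperator (ν := curveMeasure γ) (α := α) hδ (fun w => ?_) hz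
  have h := trace_le hγ hc hκp w
  rw [norm_sq_eq]
  set G := ∑ j, ‖partialDeriv j w‖ ^ 2
  set X := ‖toL2 w‖ ^ 2
  set T := ‖trace (curveMeasure γ) w‖ ^ 2
  have hG : 0 ≤ G := by positivity
  have hX : 0 ≤ X := by positivity
  have hT : α * T ≤ θ * G + κ₀ * κ * X := by
    have e1 : α * T = θ * (2 * c * κ * T) := by
      rw [hθ, hκ₀]; field_simp
    have e2 : θ * G + κ₀ * κ * X = θ * (G + κ ^ 2 * X) := by
      rw [hθ]; field_simp
    rw [e1, e2]
    gcongr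
  have m1 := mul_le_mul_of_nonneg_right (min_le_left (1 - θ) (-z.re - κ₀ * κ)) hG
  have m2 := mul_le_mul_of_nonneg_right (min_le_right (1 - θ) (-z.re - κ₀ * κ)) hX
  linarith

end LeakyCurve

theorem theorem2 (α : ℝ) (hα : 0 < α) (γ : ℝ → LeakyCurve.Plane)
    (hγ : LeakyCurve.IsInfiniteCurve γ) (hc : 0 < LeakyCurve.chordArc γ) :
    ((-(α ^ 2 / (4 * LeakyCurve.chordArc γ ^ 2)) : ℝ) : EReal) ≤
        LeakyCurve.infSpec (LeakyCurve.discreteSpec (LeakyCurve.hamiltonian α γ)) ∧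
      (LeakyCurve.AsymptoticallyStraight γ →
        ((-(α ^ 2 / (4 * LeakyCurve.chordArc γ ^ 2)) : ℝ) : EReal) ≤
          LeakyCurve.infSpec (LeakyCurve.spec (LeakyCurve.hamiltonian α γ))) := by
  have key := fun z hz =>
    LeakyCurve.le_re_of_mem_spec_hamiltonian hα hγ.lipschitzWith hc (z := z) hz
  refine ⟨le_sInf ?_, fun _ => le_sInf ?_⟩
  · rintro _ ⟨z, hz, rfl⟩
    exact EReal.coe_le_coe_iff.2 (key z hz.1)
  · rintro _ ⟨z, hz, rfl⟩
    exact EReal.coe_le_coe_iff.2 (key z hz)
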